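/- Proposition 4.1 (lower bound on the communication height). For a simple graph $G_n=([n],E_n)$ with $n\ge 2$ and for $A\subseteq[n]$ let $\partial_e A$ be the set of edges with exactly one endpoint in $A$, and let $$i_e(G_n)=\min_{A\subset[n],\ 1\le|A|\le n/2}\frac{|\partial_e A|}{|A|}$$ be the (edge) isoperimetric number. For $\sigma\in\{-1,+1\}^{[n]}$ and $h>0$ let $H(\sigma)=-\sum_{\{i,j\}\in E_n}\sigma_i\sigma_j-h\sum_{i\in[n]}\sigma_i$ be the Ising Hamiltonian. Let $\boxminus$ and $\boxplus$ be the all-minus and the all-plus configuration, and let $$\Phi(\sigma,\sigma')=\min_{\omega}\ \max_{\sigma''\in\omega}H(\sigma''),$$ where $\omega$ runs over the finite sequences of configurations, with at least one step, that lead from $\sigma$ to $\sigma'$ and in which consecutive configurations differ in exactly one spin. (i) For every simple graph $G_n$ with $n\ge2$ vertices and every $h$ with $0<h<i_e(G_n)$, $$\Phi(\boxminus,\boxplus)-H(\boxminus)\ \ge\ (i_e(G_n)-h)\cdot 2\lfloor n/2\rfloor ;$$ in particular, the right-hand side is $(i_e(G_n)-h)\,n$ when $n$ is even. (ii) For every constant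 $C_0$ with $0<C_0<\sqrt3/2-\sqrt{\log 2}$ there is a constant $C_1$ with $0<C_1<\sqrt3/2$, depending only on $C_0$, such that for every integer $r\ge3$ and every fixed $h$ with $0<h<C_0\sqrt r$, the random $r$-regular graph $G_n$ (uniform among the simple $r$-regular graphs on $[n]$, where $n>r$ and $nr$ is even) satisfies with high probability $$\Phi(\boxminus,\boxplus)-H(\boxminus)\ \ge\ \bigl(r/2-C_1\sqrt r\bigr)\,n ,$$ that is, the probability of this event tends to $1$ as $n\to\infty$ along such $n$. -/

import Mathlib

open Filter Topology ProbabilityTheory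

namespace IsingRegular

/-- The number of edges of `G` with one endpoint in `A` and the other outside `A`, counted as the
pairs `(i, j)` with `i ∈ A`, `j ∉ A` and `i`, `j` adjacent. -/
noncomputable def edgeBoundaryCard {n : ℕ} (G : SimpleGraph (Fin n)) (A : Finset (Fin n)) : ℕ := by
  classical exact (G.interedges A Aᶜ).card

/-- The values `|∂_e A| / |A|` over the nonempty vertex sets `A` with `|A| ≤ n / 2`. -/
def isoperimetricRatios {n : ℕ} (G : SimpleGraph (Fin n)) : Set ℝ :=
  {x | ∃ A : Finset (Fin n), A.Nonempty ∧ (A.card : ℝ) ≤ (n : ℝ) / 2 ∧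
    x = (edgeBoundaryCard G A : ℝ) / (A.card : ℝ)}

/-- The (edge) isoperimetric number. For `2 ≤ n` the infimum is a minimum, see
`isLeast_isoperimetricNumber`. -/
noncomputable def isoperimetricNumber {n : ℕ} (G : SimpleGraph (Fin n)) : ℝ :=
  sInf (isoperimetricRatios G)

theorem isLeast_isoperimetricNumber {n : ℕ} (hn : 2 ≤ n) (G : SimpleGraph (Fin n)) :
    IsLeast (isoperimetricRatios G) (isoperimetricNumber G) := by
  have hfin : (isoperimetricRatios G).Finite := by
    refine (Set.finite_range fun A : Finset (Fin n) =>
      (edgeBoundaryCard G A : ℝ) / (A.card : ℝ)).subset ?_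
    rintro x ⟨A, -, -, rfl⟩
    exact ⟨A, rfl⟩
  have hne : (isoperimetricRatios G).Nonempty := by
    refine ⟨_, {⟨0, by omega⟩}, Finset.singleton_nonempty _, ?_, rfl⟩
    have : (2 : ℝ) ≤ n := by exact_mod_cast hn
    simp only [Finset.card_singleton, Nat.cast_one]
    linarith
  exact ⟨hne.csInf_mem hfin, fun x hx => csInf_le hfin.bddBelow hx⟩

/-- Spin configurations: `ℤˣ` is the two-element set `{1, -1}`. -/
abbrev Config (n : ℕ) : Type := Fin n → ℤˣ

/-- The configuration with all spins equal to `-1`. -/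
def allMinus (n : ℕ) : Config n := fun _ => -1

/-- The configuration with all spins equal to `+1`. -/
def allPlus (n : ℕ) : Config n := fun _ => 1

/-- The product of the two spins at the ends of an edge. -/
def edgeSpin {n : ℕ} (σ : Config n) (e : Sym2 (Fin n)) : ℤˣ := (e.map σ).mul

theorem edgeSpin_mk {n : ℕ} (σ : Config n) (i j : Fin n) : edgeSpin σ s(i, j) = σ i * σ j := rfl

/-- The Ising Hamiltonian with interaction constant `1` and external field `h`:
`H(σ) = - ∑_{ij ∈ E} σ_i σ_j - h ∑_i σ_i`, each edge being counted once. -/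
noncomputable def hamiltonian {n : ℕ} (G : SimpleGraph (Fin n)) (h : ℝ) (σ : Config n) : ℝ := by
  classical exact
    -(∑ e ∈ G.edgeFinset, ((edgeSpin σ e : ℤ) : ℝ)) - h * ∑ i : Fin n, ((σ i : ℤ) : ℝ)

/-- `ω` is a path of length `ℓ ≥ 1` from `σ` to `σ'`: successive configurations differ in exactly
one spin. -/
def IsPath {n : ℕ} (σ σ' : Config n) (ℓ : ℕ) (ω : Fin (ℓ + 1) → Config n) : Prop :=
  1 ≤ ℓ ∧ ω 0 = σ ∧ ω (Fin.last ℓ) = σ' ∧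
    ∀ k : Fin ℓ, hammingDist (ω k.castSucc) (ω k.succ) = 1

/-- The maximal energy along a path. -/
noncomputable def pathHeight {n : ℕ} (G : SimpleGraph (Fin n)) (h : ℝ) {ℓ : ℕ}
    (ω : Fin (ℓ + 1) → Config n) : ℝ :=
  Finset.univ.sup' Finset.univ_nonempty fun k => hamiltonian G h (ω k)

/-- The maximal energies of all the paths from `σ` to `σ'`. -/
def pathHeights {n : ℕ} (G : SimpleGraph (Fin n)) (h : ℝ) (σ σ' : Config n) : Set ℝ :=
  {x | ∃ (ℓ : ℕ) (ω : Fin (ℓ + 1) → Config n), IsPath σ σ' ℓ ω ∧ x = pathHeight G h ω}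

/-- The communication height `Φ(σ, σ')`: the least maximal energy of a path from `σ` to `σ'`.
The infimum is a minimum as soon as there is a path, see `isLeast_communicationHeight`. -/
noncomputable def communicationHeight {n : ℕ} (G : SimpleGraph (Fin n)) (h : ℝ)
    (σ σ' : Config n) : ℝ :=
  sInf (pathHeights G h σ σ')

theorem isLeast_communicationHeight {n : ℕ} (G : SimpleGraph (Fin n)) (h : ℝ) (σ σ' : Config n)
    (hne : (pathHeights G h σ σ').Nonempty) :
    IsLeast (pathHeights G h σ σ') (communicationHeight G h σ σ') := by
  have hfin : (pathHeights G h σ σ').Finite := by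
    refine (Set.finite_range fun τ : Config n => hamiltonian G h τ).subset ?_
    rintro x ⟨ℓ, ω, -, rfl⟩
    obtain ⟨k, -, hk⟩ := Finset.exists_mem_eq_sup' (Finset.univ_nonempty (α := Fin (ℓ + 1)))
      (fun k => hamiltonian G h (ω k))
    exact ⟨ω k, hk.symm⟩
  exact ⟨hne.csInf_mem hfin, fun x hx => csInf_le hfin.bddBelow hx⟩

theorem pathHeights_allMinus_allPlus_nonempty {n : ℕ} (hn : 1 ≤ n) (G : SimpleGraph (Fin n))
    (h : ℝ) : (pathHeights G h (allMinus n) (allPlus n)).Nonempty := by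
  refine ⟨_, n, fun k i => if i.val < k.val then 1 else -1, ⟨hn, ?_, ?_, ?_⟩, rfl⟩
  · funext i
    simp [allMinus]
  · funext i
    simp [allPlus]
  · intro k
    have : (Finset.univ.filter fun i : Fin n =>
        (if i.val < k.castSucc.val then (1 : ℤˣ) else -1) ≠
          (if i.val < k.succ.val then (1 : ℤˣ) else -1)) = {k} := by
      ext i
      simp only [Finset.mem_filter, Finset.mem_univ, true_and, Finset.mem_singleton,
        Fin.val_castSucc, Fin.val_succ, Fin.ext_iff]
      have h1 : (-1 : ℤˣ) ≠ 1 := by decide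
      split_ifs <;> simp [h1, h1.symm] <;> omega
    unfold hammingDist
    rw [this, Finset.card_singleton]

/-- The simple `r`-regular graphs with vertex set `Fin n`. -/
def regularGraphs (n r : ℕ) : Set (SimpleGraph (Fin n)) := by
  classical exact {G | G.IsRegularOfDegree r}

/-- The singletons are events, so that every set of graphs on `Fin n` is an event. -/
instance instMeasurableSingletonClassGraph (n : ℕ) :
    MeasurableSingletonClass (SimpleGraph (Fin n)) where
  measurableSet_singleton G := by
    have : ({G} : Set (SimpleGraph (Fin n))) = SimpleGraph.Adj ⁻¹' {G.Adj} := by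
      ext G'
      simp
    rw [this]
    exact SimpleGraph.measurable_adj (measurableSet_singleton _)

theorem measurableSet_graphs {n : ℕ} (S : Set (SimpleGraph (Fin n))) : MeasurableSet S :=
  S.toFinite.measurableSet

/-- A property of graphs holds with high probability for the random `r`-regular graph: under the
uniform law on the simple `r`-regular graphs with `n` vertices, its probability tends to `1` as
`n → ∞` along the `n > r` with `n * r` even. -/
def HoldsWhp (r : ℕ) (P : (n : ℕ) → SimpleGraph (Fin n) → Prop) : Prop :=
  Tendsto (fun n : ℕ => uniformOn (regularGraphs n r) {G | P n G})
    (atTop ⊓ 𝓟 {n : ℕ | r < n ∧ Even (n * r)}) (𝓝 1)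

end IsingRegular

/-!
Flipping the spins of a set `A` of vertices from the all-minus configuration costs
`2 |∂_e A| - 2 h |A|` (`hamiltonian_sub_allMinus`), and a path from all minus to all plus has to
pass through a configuration with exactly `⌊n / 2⌋` plus spins. The communication height is
therefore at least the cheapest cost among the sets with `|A| = ⌊n / 2⌋`
(`le_communicationHeight_sub`). The first claim follows at once from the definition of the
isoperimetric number, and for the second it suffices that all bisections of the random regular
graph have at least `(r / 4 - c √r / 2) n` edges, where `c > √(log 2)` (`holdsWhp_bisection`).

The bisection bound is a first moment argument, carried out directly in the uniform simple regular
graph by switchings rather than in the configuration model. Fix `A` with `|A| = ⌊n / 2⌋` and let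
`R k` be the number of `r`-regular graphs with `k` edges leaving `A`. Replacing an edge `ab` inside
`A` and an edge `cd` outside `A` by `ac` and `bd` turns a graph counted by `R k` into one counted by
`R (k + 2)`. Counting the switchings from both sides gives, with `M = r |A| / 2` the typical value
of `k`,
`R k * ((2 M - k) ^ 2 - 2 k r ^ 2) ≤ R (k + 2) * (k + 2) ^ 2` (`card_regularCut_mul_le`).
With `y = M - k - 2` the ratio `R k / R (k + 2)` is thus at most
`((M - y) / (M + y)) ^ 2 * (1 + O(1 / M)) ≤ exp (-4 y / M + O(1 / M))`, and multiplying these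
ratios up to `k ≈ M` yields `R k ≤ C * exp (-(M - k) ^ 2 / M) * ∑ j, R j` with `C` depending on `r`
only (`card_regularCut_le`). For `k ≤ (r / 4 - c √r / 2) n` the exponent is
`-c ^ 2 n + O(1)`, which beats the `2 ^ n` choices of `A` and the linear number of values of `k`
because `c ^ 2 > log 2` (`card_filter_small_bisection_le`). A circulant graph shows that the uniform
law lives on a nonempty set (`regularGraphs_nonempty`).
-/

namespace IsingRegular

/-! ### Energy barrier at half magnetization -/

open scoped Classical in
theorem edgeBoundaryCard_eq {n : ℕ} (G : SimpleGraph (Fin n)) (A : Finset (Fin n)) :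
    edgeBoundaryCard G A = (G.interedges A Aᶜ).card := by
  unfold edgeBoundaryCard
  congr!

/-- The set of vertices with spin `+1`. -/
def plusSet {n : ℕ} (σ : Config n) : Finset (Fin n) := {i | σ i = 1}

theorem mem_plusSet {n : ℕ} {σ : Config n} {i : Fin n} : i ∈ plusSet σ ↔ σ i = 1 := by
  simp [plusSet]

theorem plusSet_allMinus (n : ℕ) : plusSet (allMinus n) = ∅ := by
  ext i
  simp only [mem_plusSet, allMinus, Finset.notMem_empty, iff_false]
  decide

theorem plusSet_allPlus (n : ℕ) : plusSet (allPlus n) = Finset.univ := by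
  ext i
  simp [mem_plusSet, allPlus]

theorem coe_unit_eq (u : ℤˣ) : ((u : ℤ) : ℝ) = 2 * (if u = 1 then 1 else 0) - 1 := by
  rcases Int.units_eq_one_or u with rfl | rfl
  · norm_num
  · have : (-1 : ℤˣ) ≠ 1 := by decide
    simp [this]

theorem sum_spin {n : ℕ} (σ : Config n) :
    ∑ i : Fin n, ((σ i : ℤ) : ℝ) = 2 * ((plusSet σ).card : ℝ) - n := by
  simp only [coe_unit_eq, Finset.sum_sub_distrib, ← Finset.mul_sum, Finset.sum_boole, plusSet]
  simp

open scoped Classical in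
/-- The edges on which the spins disagree are the edges leaving the set of `+1` spins. -/
theorem card_filter_edgeSpin {n : ℕ} (G : SimpleGraph (Fin n)) (σ : Config n) :
    (G.edgeFinset.filter fun e => ¬ edgeSpin σ e = 1).card = edgeBoundaryCard G (plusSet σ) := by
  rw [edgeBoundaryCard_eq]
  symm
  refine Finset.card_bij (fun p _ => s(p.1, p.2)) ?_ ?_ ?_
  · rintro ⟨i, j⟩ hij
    rw [SimpleGraph.mem_interedges_iff] at hij
    simp only [Finset.mem_compl, mem_plusSet] at hij
    simp only [Finset.mem_filter, SimpleGraph.mem_edgeFinset, SimpleGraph.mem_edgeSet,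
      edgeSpin_mk, hij.1, one_mul]
    exact ⟨hij.2.2, hij.2.1⟩
  · rintro ⟨i, j⟩ hij ⟨i', j'⟩ hij' h
    rw [SimpleGraph.mem_interedges_iff] at hij hij'
    simp only [Finset.mem_compl] at hij hij'
    simp only [Sym2.eq_iff] at h
    grind
  · intro e
    induction e using Sym2.ind with
    | _ i j =>
      simp only [Finset.mem_filter, SimpleGraph.mem_edgeFinset, SimpleGraph.mem_edgeSet,
        edgeSpin_mk]
      rintro ⟨hadj, hne⟩
      rcases Int.units_eq_one_or (σ i) with hi | hi <;>
        rcases Int.units_eq_one_or (σ j) with hj | hj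
      · simp [hi, hj] at hne
      · refine ⟨(i, j), ?_, rfl⟩
        rw [SimpleGraph.mem_interedges_iff]
        simp only [Finset.mem_compl, mem_plusSet, hi, hj, true_and]
        exact ⟨by decide, hadj⟩
      · refine ⟨(j, i), ?_, Sym2.eq_swap⟩
        rw [SimpleGraph.mem_interedges_iff]
        simp only [Finset.mem_compl, mem_plusSet, hi, hj, true_and]
        exact ⟨by decide, hadj.symm⟩
      · simp [hi, hj] at hne

open scoped Classical in
theorem hamiltonian_eq {n : ℕ} (G : SimpleGraph (Fin n)) (h : ℝ) (σ : Config n) :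
    hamiltonian G h σ = 2 * edgeBoundaryCard G (plusSet σ) - G.edgeFinset.card
      - h * (2 * (plusSet σ).card - n) := by
  have h1 : hamiltonian G h σ = -(∑ e ∈ G.edgeFinset, ((edgeSpin σ e : ℤ) : ℝ))
      - h * ∑ i : Fin n, ((σ i : ℤ) : ℝ) := by
    unfold hamiltonian
    congr!
  have h2 := Finset.card_filter_add_card_filter_not (s := G.edgeFinset)
    (fun e => edgeSpin σ e = 1)
  rw [card_filter_edgeSpin] at h2
  rw [h1, sum_spin, ← h2]
  simp only [coe_unit_eq, Finset.sum_sub_distrib, ← Finset.mul_sum, Finset.sum_boole,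
    Finset.sum_const, nsmul_eq_mul, mul_one, ← h2]
  push_cast
  ring

/-- Energy of a configuration relative to all minus, in terms of the set of `+1` spins. -/
theorem hamiltonian_sub_allMinus {n : ℕ} (G : SimpleGraph (Fin n)) (h : ℝ) (σ : Config n) :
    hamiltonian G h σ - hamiltonian G h (allMinus n) =
      2 * edgeBoundaryCard G (plusSet σ) - 2 * h * (plusSet σ).card := by
  have h0 : edgeBoundaryCard G ∅ = 0 := by
    simp [edgeBoundaryCard, SimpleGraph.interedges, Rel.interedges]
  rw [hamiltonian_eq, hamiltonian_eq, plusSet_allMinus, h0]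
  simp
  ring

theorem card_plusSet_le_succ {n : ℕ} {σ τ : Config n} (h : hammingDist σ τ = 1) :
    (plusSet τ).card ≤ (plusSet σ).card + 1 := by
  unfold hammingDist at h
  rw [← h]
  refine (Finset.card_le_card ?_).trans (Finset.card_union_le _ _)
  intro i hi
  rw [mem_plusSet] at hi
  by_cases hs : σ i = 1
  · simp [mem_plusSet, hs]
  · simp [hi, hs]

/-- A path from all minus to all plus visits every magnetization. -/
theorem IsPath.exists_card_plusSet {n ℓ : ℕ} {ω : Fin (ℓ + 1) → Config n}
    (hω : IsPath (allMinus n) (allPlus n) ℓ ω) {m : ℕ} (hm : m ≤ n) :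
    ∃ k, (plusSet (ω k)).card = m := by
  obtain ⟨-, h0, h1, hstep⟩ := hω
  by_contra! hne
  have hlt : ∀ k, (plusSet (ω k)).card < m := by
    intro k
    induction k using Fin.induction with
    | zero =>
      have := hne 0
      rw [h0, plusSet_allMinus, Finset.card_empty] at this ⊢
      omega
    | succ k ih =>
      have := hne k.succ
      have := card_plusSet_le_succ (hstep k)
      omega
  have := hlt (Fin.last ℓ)
  rw [h1, plusSet_allPlus, Finset.card_univ, Fintype.card_fin] at this
  omega

/-- The saddle has to be at least as high as the lowest configuration with `⌊n / 2⌋` plus spins. -/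
theorem le_communicationHeight_sub {n : ℕ} (hn : 1 ≤ n) (G : SimpleGraph (Fin n)) (h b : ℝ)
    (hb : ∀ A : Finset (Fin n), A.card = n / 2 → b ≤ 2 * edgeBoundaryCard G A - 2 * h * A.card) :
    b ≤ communicationHeight G h (allMinus n) (allPlus n) - hamiltonian G h (allMinus n) := by
  obtain ⟨ℓ, ω, hω, hΦ⟩ := (isLeast_communicationHeight G h _ _
    (pathHeights_allMinus_allPlus_nonempty hn G h)).1
  obtain ⟨k, hk⟩ := hω.exists_card_plusSet (Nat.div_le_self n 2)
  have h1 := hb _ hk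
  rw [← hamiltonian_sub_allMinus] at h1
  have h2 : hamiltonian G h (ω k) ≤ pathHeight G h ω :=
    Finset.le_sup' (fun k => hamiltonian G h (ω k)) (Finset.mem_univ k)
  linarith

theorem communicationHeight_ge_isoperimetric {n : ℕ} (hn : 2 ≤ n) (G : SimpleGraph (Fin n))
    (h : ℝ) : (isoperimetricNumber G - h) * (2 * (⌊(n : ℝ) / 2⌋₊ : ℝ)) ≤
      communicationHeight G h (allMinus n) (allPlus n) - hamiltonian G h (allMinus n) := by
  refine le_communicationHeight_sub (by omega) G h _ fun A hA => ?_
  have hpos : 0 < A.card := by omega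
  have hle : (A.card : ℝ) ≤ (n : ℝ) / 2 := by rw [hA]; exact_mod_cast Nat.cast_div_le
  have h1 := (isLeast_isoperimetricNumber hn G).2 ⟨A, Finset.card_pos.1 hpos, hle, rfl⟩
  rw [le_div_iff₀ (by exact_mod_cast hpos)] at h1
  have h2 : ⌊(n : ℝ) / 2⌋₊ = A.card := by
    rw [hA]
    exact_mod_cast Nat.floor_div_natCast (n : ℝ) 2 |>.trans (by simp)
  rw [h2]
  linarith

/-! ### Existence of regular graphs -/

theorem mem_regularGraphs {n r : ℕ} {G : SimpleGraph (Fin n)} [DecidableRel G.Adj] :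
    G ∈ regularGraphs n r ↔ ∀ v, G.degree v = r := by
  unfold regularGraphs SimpleGraph.IsRegularOfDegree
  simp only [Set.mem_ofPred_eq]
  congr!

/-- There are `r`-regular graphs on `n` vertices whenever `r < n` and `n * r` is even: take the
circulant graph whose connection set consists of the `2 * (r / 2)` smallest nonzero residues in
absolute value and, for odd `r`, of the antipode `n / 2`. -/
theorem regularGraphs_nonempty {n r : ℕ} (hn : r < n) (he : Even (n * r)) :
    (regularGraphs n r).Nonempty := by
  classical
  have : NeZero n := ⟨by omega⟩
  set p : ℕ → Prop := fun x => (1 ≤ x ∧ x ≤ r / 2) ∨ (n - r / 2 ≤ x ∧ x ≤ n - 1) ∨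
    (r % 2 = 1 ∧ x = n / 2) with hp
  -- The antipode is its own negative, since `n` is even when it is used.
  have hpar : r % 2 = 1 → n % 2 = 0 := by
    intro hr
    rcases Nat.even_mul.1 he with h | h
    · exact Nat.even_iff.1 h
    · rw [Nat.even_iff] at h; omega
  have hneg : ∀ x : Fin n, p x.val → p (-x).val := by
    intro x hx
    rw [Fin.val_neg]
    have := x.isLt
    simp only [hp] at hx ⊢
    split_ifs with h0
    · subst h0
      simp at hx
      omega
    · omega
  let G : SimpleGraph (Fin n) :=
    { Adj := fun v w => p (w - v).val
      symm := ⟨fun v w h => by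
        have := hneg _ h
        rwa [neg_sub] at this⟩
      loopless := ⟨fun v h => by
        simp only [sub_self, hp, Fin.val_zero] at h
        omega⟩ }
  refine ⟨G, mem_regularGraphs.2 fun v => ?_⟩
  have h1 : G.degree v = (((Finset.univ : Finset (Fin n)).filter fun x => p x.val)).card := by
    rw [← SimpleGraph.card_neighborFinset_eq_degree]
    refine Finset.card_bij (fun w _ => w - v) ?_ ?_ ?_
    · intro w hw
      simpa [G] using hw
    · intro w _ w' _ h
      exact sub_left_injective h
    · intro x hx
      exact ⟨x + v, by simpa [G] using hx, by simp⟩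
  have h2 : (((Finset.univ : Finset (Fin n)).filter fun x => p x.val)).card
      = ((Finset.Icc 1 (r / 2) ∪ Finset.Icc (n - r / 2) (n - 1)) ∪
        (if r % 2 = 1 then {n / 2} else ∅)).card := by
    refine Finset.card_bij (fun x _ => x.val) ?_ (fun x _ y _ h => Fin.ext h) ?_
    · intro x hx
      simp only [hp, Finset.mem_filter, Finset.mem_univ, true_and] at hx
      simp only [Finset.mem_union, Finset.mem_Icc]
      split_ifs <;> simp only [Finset.mem_singleton, Finset.notMem_empty] <;> omega
    · intro x hx
      have hx' : p x := by
        simp only [Finset.mem_union, Finset.mem_Icc] at hx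
        simp only [hp]
        split_ifs at hx with h
        · simp only [Finset.mem_singleton] at hx; omega
        · simp only [Finset.notMem_empty, or_false] at hx; omega
      have hlt : x < n := by
        simp only [hp] at hx'
        omega
      exact ⟨⟨x, hlt⟩, by simpa using hx', rfl⟩
  have h3 : Disjoint (Finset.Icc 1 (r / 2)) (Finset.Icc (n - r / 2) (n - 1)) := by
    rw [Finset.disjoint_left]
    intro x hx hx'
    rw [Finset.mem_Icc] at hx hx'
    omega
  rw [h1, h2]
  split_ifs with hr
  · rw [Finset.card_union_of_disjoint, Finset.card_union_of_disjoint h3]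
    · simp only [Nat.card_Icc, Finset.card_singleton]
      omega
    · rw [Finset.disjoint_singleton_right, Finset.mem_union, Finset.mem_Icc, Finset.mem_Icc]
      have := hpar hr
      omega
  · rw [Finset.union_empty, Finset.card_union_of_disjoint h3]
    simp only [Nat.card_Icc]
    omega

/-! ### Switchings -/

section Switching

variable {V : Type*}

/-- The graph obtained from `G` by replacing the edges `ab` and `cd` with `ac` and `bd`. -/
def switch (G : SimpleGraph V) (a b c d : V) : SimpleGraph V :=
  (G \ SimpleGraph.fromEdgeSet {s(a, b), s(c, d)}) ⊔ SimpleGraph.fromEdgeSet {s(a, c), s(b, d)}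

/-- The edges `ab` inside `A` and `cd` outside `A` can be switched to the edges `ac` and `bd`
without creating a double edge. -/
structure Switchable (G : SimpleGraph V) (A : Finset V) (a b c d : V) : Prop where
  adj_ab : G.Adj a b
  adj_cd : G.Adj c d
  not_adj_ac : ¬ G.Adj a c
  not_adj_bd : ¬ G.Adj b d
  a_mem : a ∈ A
  b_mem : b ∈ A
  c_notMem : c ∉ A
  d_notMem : d ∉ A

/-- The entry at `(v, w)` of the sum of the matrix units at `(a, b)` and `(b, a)`. -/
def edgeInd [DecidableEq V] (a b v w : V) : ℤ :=
  (if v = a then 1 else 0) * (if w = b then 1 else 0) +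
    (if v = b then 1 else 0) * (if w = a then 1 else 0)

theorem sum_sum_edgeInd [DecidableEq V] (a b : V) (S T : Finset V) :
    ∑ v ∈ S, ∑ w ∈ T, edgeInd a b v w =
      (if a ∈ S then 1 else 0) * (if b ∈ T then 1 else 0) +
        (if b ∈ S then 1 else 0) * (if a ∈ T then 1 else 0) := by
  simp only [edgeInd, Finset.sum_add_distrib, ← Finset.mul_sum, ← Finset.sum_mul,
    Finset.sum_ite_eq']

open scoped Classical in
/-- The effect of a switching on the adjacency matrix. Row and block sums of this identity give the
effect on degrees and on cuts. -/
theorem Switchable.adj_ind [DecidableEq V] {G : SimpleGraph V} {A : Finset V} {a b c d : V}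
    (h : Switchable G A a b c d) (v w : V) :
    (if (switch G a b c d).Adj v w then 1 else 0 : ℤ) = (if G.Adj v w then 1 else 0)
      - edgeInd a b v w - edgeInd c d v w + edgeInd a c v w + edgeInd b d v w := by
  obtain ⟨h1, h2, h3, h4, ha, hb, hc, hd⟩ := h
  have hab := h1.ne
  have hcd := h2.ne
  have hac : a ≠ c := fun h => hc (h ▸ ha)
  have had : a ≠ d := fun h => hd (h ▸ ha)
  have hbc : b ≠ c := fun h => hc (h ▸ hb)
  have hbd : b ≠ d := fun h => hd (h ▸ hb)
  have h1' := h1.symm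
  have h2' := h2.symm
  have h3' : ¬ G.Adj c a := fun h => h3 h.symm
  have h4' : ¬ G.Adj d b := fun h => h4 h.symm
  simp only [switch, SimpleGraph.sup_adj, SimpleGraph.sdiff_adj, SimpleGraph.fromEdgeSet_adj,
    Set.mem_insert_iff, Set.mem_singleton_iff, Sym2.eq_iff, edgeInd]
  clear ha hb hc hd
  by_cases hva : v = a
  · subst hva; grind
  by_cases hvb : v = b
  · subst hvb; grind
  by_cases hvc : v = c
  · subst hvc; grind
  by_cases hvd : v = d
  · subst hvd; grind
  simp [hva, hvb, hvc, hvd]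

open scoped Classical in
theorem card_interedges_eq_sum (G : SimpleGraph V) (S T : Finset V) :
    ((G.interedges S T).card : ℤ) = ∑ v ∈ S, ∑ w ∈ T, if G.Adj v w then 1 else 0 := by
  rw [← Finset.sum_product', SimpleGraph.interedges_def, Finset.sum_boole]

open scoped Classical in
theorem Switchable.card_interedges_switch [DecidableEq V] {G : SimpleGraph V} {A : Finset V}
    {a b c d : V} (h : Switchable G A a b c d) (S T : Finset V) :
    (((switch G a b c d).interedges S T).card : ℤ) = (G.interedges S T).card
      - ∑ v ∈ S, ∑ w ∈ T, edgeInd a b v w - ∑ v ∈ S, ∑ w ∈ T, edgeInd c d v w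
      + ∑ v ∈ S, ∑ w ∈ T, edgeInd a c v w + ∑ v ∈ S, ∑ w ∈ T, edgeInd b d v w := by
  simp only [card_interedges_eq_sum, h.adj_ind, Finset.sum_add_distrib, Finset.sum_sub_distrib]

open scoped Classical in
theorem card_interedges_singleton_univ [Fintype V] (G : SimpleGraph V) (v : V) :
    (G.interedges {v} Finset.univ).card = G.degree v := by
  rw [← SimpleGraph.card_neighborFinset_eq_degree]
  refine Finset.card_bij (fun p _ => p.2) ?_ ?_ ?_
  · rintro ⟨x, y⟩ h
    rw [SimpleGraph.mk_mem_interedges_iff] at h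
    simp only [Finset.mem_singleton] at h
    simpa [← h.1] using h.2.2
  · rintro ⟨x, y⟩ h ⟨x', y'⟩ h' rfl
    rw [SimpleGraph.mk_mem_interedges_iff] at h h'
    simp only [Finset.mem_singleton] at h h'
    rw [h.1, h'.1]
  · intro w hw
    exact ⟨(v, w), by simpa [SimpleGraph.mk_mem_interedges_iff] using hw, rfl⟩

open scoped Classical in
theorem Switchable.degree_switch [Fintype V] [DecidableEq V] {G : SimpleGraph V}
    {A : Finset V} {a b c d : V} (h : Switchable G A a b c d) (v : V) :
    (switch G a b c d).degree v = G.degree v := by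
  have := h.card_interedges_switch {v} Finset.univ
  rw [card_interedges_singleton_univ, card_interedges_singleton_univ] at this
  simp only [sum_sum_edgeInd, Finset.mem_univ, if_true] at this
  zify
  rw [this]
  ring

open scoped Classical in
theorem Switchable.card_interedges_compl_switch [Fintype V] [DecidableEq V] {G : SimpleGraph V}
    {A : Finset V} {a b c d : V} (h : Switchable G A a b c d) :
    ((switch G a b c d).interedges A Aᶜ).card = (G.interedges A Aᶜ).card + 2 := by
  have := h.card_interedges_switch A Aᶜ
  simp only [sum_sum_edgeInd, Finset.mem_compl, h.a_mem, h.b_mem, h.c_notMem, h.d_notMem] at this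
  zify
  rw [this]
  simp
  ring

theorem Switchable.switch_adj_ac {G : SimpleGraph V} {A : Finset V} {a b c d : V}
    (h : Switchable G A a b c d) : (switch G a b c d).Adj a c := by
  have : a ≠ c := fun e => h.c_notMem (e ▸ h.a_mem)
  simp [switch, this]

theorem Switchable.switch_adj_bd {G : SimpleGraph V} {A : Finset V} {a b c d : V}
    (h : Switchable G A a b c d) : (switch G a b c d).Adj b d := by
  have : b ≠ d := fun e => h.d_notMem (e ▸ h.b_mem)
  simp [switch, this]

/-- A switching can be undone, given the four vertices. -/
theorem Switchable.eq_of_switch_eq {G G' : SimpleGraph V} {A : Finset V} {a b c d : V}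
    (h : Switchable G A a b c d) (h' : Switchable G' A a b c d)
    (heq : switch G a b c d = switch G' a b c d) : G = G' := by
  classical
  ext v w
  have h1 := h.adj_ind v w
  have h2 := h'.adj_ind v w
  rw [heq] at h1
  by_cases hG : G.Adj v w <;> by_cases hG' : G'.Adj v w <;> simp only [hG, hG', if_true,
    if_false] at h1 h2 ⊢ <;> omega

open scoped Classical in
/-- The ways to switch an edge inside `A` and an edge outside `A`, each with an orientation. -/
noncomputable def switchings [Fintype V] [DecidableEq V] (G : SimpleGraph V) (A : Finset V) :
    Finset ((V × V) × (V × V)) :=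
  {q | Switchable G A q.1.1 q.1.2 q.2.1 q.2.2}

open scoped Classical in
theorem card_interedges_add_card_interedges_compl [Fintype V] [DecidableEq V]
    {G : SimpleGraph V} {r : ℕ} (hG : ∀ v, G.degree v = r) (S A : Finset V) :
    (G.interedges S A).card + (G.interedges S Aᶜ).card = r * S.card := by
  zify
  simp only [card_interedges_eq_sum]
  rw [← Finset.sum_add_distrib]
  simp only [Finset.sum_add_sum_compl]
  have : ∀ v ∈ S, ∑ w, (if G.Adj v w then 1 else 0 : ℤ) = r := by
    intro v _
    have h := card_interedges_eq_sum G {v} Finset.univ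
    rw [card_interedges_singleton_univ, hG, Finset.sum_singleton] at h
    exact h.symm
  rw [Finset.sum_congr rfl this]
  simp [mul_comm]

open scoped Classical in
/-- A pair of oriented edges, one inside and one outside `A`, fails to be switchable only if `ac` or
`bd` is an edge, and each edge leaving `A` spoils at most `r ^ 2` such pairs. -/
theorem card_switchings_ge [Fintype V] [DecidableEq V]
    {G : SimpleGraph V} {r : ℕ} (hG : ∀ v, G.degree v = r) (A : Finset V) :
    (G.interedges A A).card * (G.interedges Aᶜ Aᶜ).card ≤
      (switchings G A).card + 2 * ((G.interedges A Aᶜ).card * r ^ 2) := by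
  -- `B₁` and `B₂` contain the pairs spoilt by an edge `ac` and by an edge `bd`.
  set N : V → Finset V := fun v => G.neighborFinset v with hN
  set B₁ : Finset ((V × V) × (V × V)) := (G.interedges A Aᶜ).biUnion fun p =>
    (N p.1 ×ˢ N p.2).image fun q => ((p.1, q.1), (p.2, q.2)) with hB₁
  set B₂ : Finset ((V × V) × (V × V)) := (G.interedges A Aᶜ).biUnion fun p =>
    (N p.1 ×ˢ N p.2).image fun q => ((q.1, p.1), (q.2, p.2)) with hB₂
  have hcard : ∀ p : V × V, (N p.1 ×ˢ N p.2).card = r ^ 2 := by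
    intro p
    rw [Finset.card_product, SimpleGraph.card_neighborFinset_eq_degree,
      SimpleGraph.card_neighborFinset_eq_degree, hG, hG, sq]
  have h1 : B₁.card ≤ (G.interedges A Aᶜ).card * r ^ 2 :=
    Finset.card_biUnion_le_card_mul _ _ _ fun p _ => Finset.card_image_le.trans (hcard p).le
  have h2 : B₂.card ≤ (G.interedges A Aᶜ).card * r ^ 2 :=
    Finset.card_biUnion_le_card_mul _ _ _ fun p _ => Finset.card_image_le.trans (hcard p).le
  have h3 : G.interedges A A ×ˢ G.interedges Aᶜ Aᶜ ⊆ switchings G A ∪ (B₁ ∪ B₂) := by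
    rintro ⟨⟨a, b⟩, ⟨c, d⟩⟩ hq
    rw [Finset.mem_product, SimpleGraph.mk_mem_interedges_iff,
      SimpleGraph.mk_mem_interedges_iff, Finset.mem_compl, Finset.mem_compl] at hq
    obtain ⟨⟨ha, hb, hab⟩, hc, hd, hcd⟩ := hq
    rw [Finset.mem_union, Finset.mem_union]
    by_cases hac : G.Adj a c
    · right; left
      refine Finset.mem_biUnion.2 ⟨(a, c), ?_, Finset.mem_image.2 ⟨(b, d), ?_, rfl⟩⟩
      · rw [SimpleGraph.mk_mem_interedges_iff, Finset.mem_compl]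
        exact ⟨ha, hc, hac⟩
      · simp [hN, hab, hcd]
    by_cases hbd : G.Adj b d
    · right; right
      refine Finset.mem_biUnion.2 ⟨(b, d), ?_, Finset.mem_image.2 ⟨(a, c), ?_, rfl⟩⟩
      · rw [SimpleGraph.mk_mem_interedges_iff, Finset.mem_compl]
        exact ⟨hb, hd, hbd⟩
      · simp [hN, hab.symm, hcd.symm]
    · left
      simp only [switchings, Finset.mem_filter, Finset.mem_univ, true_and]
      exact ⟨hab, hcd, hac, hbd, ha, hb, hc, hd⟩
  have h4 := Finset.card_le_card h3
  rw [Finset.card_product] at h4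
  have h5 := Finset.card_union_le (switchings G A) (B₁ ∪ B₂)
  have h6 := Finset.card_union_le B₁ B₂
  omega

end Switching

open scoped Classical in
/-- The `r`-regular graphs with exactly `k` edges leaving `A`. -/
noncomputable def regularCut (n r : ℕ) (A : Finset (Fin n)) (k : ℕ) :
    Finset (SimpleGraph (Fin n)) :=
  {G | G ∈ regularGraphs n r ∧ edgeBoundaryCard G A = k}

open scoped Classical in
theorem mem_regularCut {n r : ℕ} {A : Finset (Fin n)} {k : ℕ} {G : SimpleGraph (Fin n)} :
    G ∈ regularCut n r A k ↔ (∀ v, G.degree v = r) ∧ (G.interedges A Aᶜ).card = k := by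
  rw [← edgeBoundaryCard_eq, ← mem_regularGraphs]
  simp [regularCut]

/-- Double counting of the switchings that lead from `k` to `k + 2` edges leaving `A`. -/
theorem card_regularCut_mul_le {n r : ℕ} (A : Finset (Fin n)) (k : ℕ) :
    ((regularCut n r A k).card : ℝ) *
        ((r * A.card - k) * (r * (n - A.card) - k) - 2 * k * r ^ 2) ≤
      (regularCut n r A (k + 2)).card * ((k : ℝ) + 2) ^ 2 := by
  classical
  have h1 : ((regularCut n r A k).sigma fun G => switchings G A).card ≤
      ((regularCut n r A (k + 2)).sigma fun G =>
        G.interedges A Aᶜ ×ˢ G.interedges A Aᶜ).card := by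
    refine Finset.card_le_card_of_injOn (fun x => ⟨switch x.1 x.2.1.1 x.2.1.2 x.2.2.1 x.2.2.2,
      ((x.2.1.1, x.2.2.1), (x.2.1.2, x.2.2.2))⟩) ?_ ?_
    · rintro ⟨G, ⟨a, b⟩, ⟨c, d⟩⟩ hx
      simp only [Finset.coe_sigma, Set.mem_sigma_iff, Finset.mem_coe, mem_regularCut, switchings,
        Finset.mem_filter, Finset.mem_univ, true_and] at hx
      obtain ⟨⟨hG, hk⟩, hs⟩ := hx
      simp only [Finset.coe_sigma, Set.mem_sigma_iff, Finset.mem_coe, mem_regularCut,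
        Finset.mem_product, SimpleGraph.mk_mem_interedges_iff, Finset.mem_compl]
      exact ⟨⟨fun v => (hs.degree_switch v).trans (hG v),
        by rw [hs.card_interedges_compl_switch, hk]⟩,
        ⟨hs.a_mem, hs.c_notMem, hs.switch_adj_ac⟩, hs.b_mem, hs.d_notMem, hs.switch_adj_bd⟩
    · rintro ⟨G, ⟨a, b⟩, ⟨c, d⟩⟩ hx ⟨G', ⟨a', b'⟩, ⟨c', d'⟩⟩ hx' heq
      simp only [Finset.coe_sigma, Set.mem_sigma_iff, Finset.mem_coe, switchings,
        Finset.mem_filter, Finset.mem_univ, true_and] at hx hx'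
      simp only [Sigma.mk.injEq, heq_eq_eq, Prod.mk.injEq] at heq
      obtain ⟨heq, ⟨rfl, rfl⟩, rfl, rfl⟩ := heq
      rw [hx.2.eq_of_switch_eq hx'.2 heq]
  have h2 : ((regularCut n r A (k + 2)).sigma fun G =>
      G.interedges A Aᶜ ×ˢ G.interedges A Aᶜ).card =
        (regularCut n r A (k + 2)).card * (k + 2) ^ 2 := by
    rw [Finset.card_sigma, Finset.sum_const_nat]
    intro G hG
    rw [Finset.card_product, (mem_regularCut.1 hG).2, sq]
  have h3 : ((regularCut n r A k).card : ℝ) *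
      ((r * A.card - k) * (r * (n - A.card) - k) - 2 * k * r ^ 2) ≤
        ((regularCut n r A k).sigma fun G => switchings G A).card := by
    rw [Finset.card_sigma, Nat.cast_sum, ← nsmul_eq_mul]
    refine Finset.card_nsmul_le_sum _ _ _ fun G hG => ?_
    obtain ⟨hr, hk⟩ := mem_regularCut.1 hG
    have e1 := card_interedges_add_card_interedges_compl hr A A
    have e2 := card_interedges_add_card_interedges_compl hr Aᶜ A
    have := G.symm
    have e0 : (G.interedges Aᶜ A).card = (G.interedges A Aᶜ).card :=
      Rel.card_interedges_comm _ _
    rw [e0] at e2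
    have e3 := card_switchings_ge hr A
    have e4 := Finset.card_add_card_compl A
    rw [Fintype.card_fin] at e4
    rw [hk] at e1 e2 e3
    rify at e1 e2 e3 e4
    have f1 : (r * A.card - k : ℝ) = (G.interedges A A).card := by linarith
    have f2 : (r * (n - A.card) - k : ℝ) = (G.interedges Aᶜ Aᶜ).card := by
      rw [← e4, add_sub_cancel_left]
      linarith
    rw [f1, f2]
    linarith
  refine h3.trans ?_
  have := h1.trans_eq h2
  exact_mod_cast this

/-! ### Decay of the number of regular graphs with a small cut -/

/-- The inequality `2 x ≤ log ((1 + x) / (1 - x))`. -/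
theorem one_sub_le_one_add_mul_exp {x : ℝ} (h0 : 0 ≤ x) (h1 : x ≤ 1) :
    1 - x ≤ (1 + x) * Real.exp (-2 * x) := by
  rcases h1.eq_or_lt with rfl | h1
  · rw [sub_self]; positivity
  have hx : 0 < 1 - x := by linarith
  have h2 := Real.le_log_one_add_of_nonneg (x := 2 * x / (1 - x)) (by positivity)
  have e1 : 2 * (2 * x / (1 - x)) / (2 * x / (1 - x) + 2) = 2 * x := by field_simp; ring
  have e2 : 1 + 2 * x / (1 - x) = (1 + x) / (1 - x) := by field_simp; ring
  rw [e1, e2, Real.le_log_iff_exp_le (by positivity), le_div_iff₀ hx] at h2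
  have h3 := mul_le_mul_of_nonneg_left h2 (Real.exp_pos (-2 * x)).le
  rw [← mul_assoc, ← Real.exp_add] at h3
  simp only [neg_mul, neg_add_cancel, Real.exp_zero, one_mul] at h3 ⊢
  linarith

section Decay

variable {n r : ℕ} {A : Finset (Fin n)} {M : ℝ}

/-- The ratio bound obtained from the switchings. Only `|A| ≤ n - |A|` is needed, which covers odd
`n` as well. -/
theorem card_regularCut_le_step (hA : 2 * A.card ≤ n) (hM : M = r * A.card / 2) (hMpos : 0 < M)
    (hr : 4 * (r : ℝ) ^ 2 ≤ M) {k : ℕ} (hk : (k : ℝ) + 2 ≤ M) :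
    ((regularCut n r A k).card : ℝ) ≤ (regularCut n r A (k + 2)).card *
      Real.exp (-4 * (M - k - 2) / M + 4 * r ^ 2 / M) := by
  set R := ((regularCut n r A k).card : ℝ)
  set R' := ((regularCut n r A (k + 2)).card : ℝ)
  have hR : 0 ≤ R := Nat.cast_nonneg _
  have hR' : 0 ≤ R' := Nat.cast_nonneg _
  have hk0 : (0 : ℝ) ≤ k := Nat.cast_nonneg _
  have hsw : R * ((r * A.card - k) * (r * (n - A.card) - k) - 2 * k * r ^ 2) ≤
      R' * ((k : ℝ) + 2) ^ 2 := card_regularCut_mul_le A k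
  -- In terms of `y` one has `k + 2 = M - y` and `r |A| - k = M + y + 2`; the error made by the
  -- spoilt pairs is the factor `1 - u`.
  obtain ⟨y, hy⟩ : ∃ y, y = M - k - 2 := ⟨_, rfl⟩
  have hy0 : 0 ≤ y := by linarith
  obtain ⟨u, hu⟩ : ∃ u, u = 2 * (r : ℝ) ^ 2 / M := ⟨_, rfl⟩
  have hu0 : 0 ≤ u := by rw [hu]; positivity
  have hu1 : u ≤ 1 / 2 := by rw [hu, div_le_iff₀ hMpos]; linarith
  have huM : u * M = 2 * r ^ 2 := by rw [hu]; field_simp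
  have hA' : (2 : ℝ) * A.card ≤ n := by exact_mod_cast hA
  have hr0 : (0 : ℝ) ≤ r := Nat.cast_nonneg _
  have hD : (M + y) ^ 2 * (1 - u) ≤
      (r * A.card - k) * (r * (n - A.card) - k) - 2 * k * r ^ 2 := by
    have f1 : M + y ≤ r * A.card - k := by linarith
    have f2 : M + y ≤ r * (n - A.card) - k := by nlinarith
    have f3 : (M + y) * (M + y) ≤ (r * A.card - k) * (r * (n - A.card) - k) :=
      mul_le_mul f1 f2 (by linarith) (by linarith)
    have f4 : 2 * k * (r : ℝ) ^ 2 ≤ M * M * u := by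
      rw [mul_assoc M, mul_comm M u, huM]
      nlinarith [sq_nonneg (r : ℝ)]
    have f5 : M * M * u ≤ (M + y) ^ 2 * u := by
      apply mul_le_mul_of_nonneg_right _ hu0
      nlinarith
    linarith
  have hx := one_sub_le_one_add_mul_exp (x := y / M) (by positivity)
    (by rw [div_le_one hMpos]; linarith)
  have hB : (k : ℝ) + 2 ≤ (M + y) * Real.exp (-2 * (y / M)) := by
    have := mul_le_mul_of_nonneg_left hx hMpos.le
    rw [← mul_assoc, mul_sub, mul_add, mul_div_cancel₀ _ hMpos.ne'] at this
    linarith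
  have hB2 : ((k : ℝ) + 2) ^ 2 ≤ (M + y) ^ 2 * Real.exp (-4 * (y / M)) := by
    have := pow_le_pow_left₀ (by positivity) hB 2
    have he : Real.exp (-2 * (y / M)) ^ 2 = Real.exp (-4 * (y / M)) := by
      rw [← Real.exp_nat_mul]
      push_cast
      ring_nf
    rwa [mul_pow, he] at this
  have h1 : (M + y) ^ 2 * (R * (1 - u)) ≤ (M + y) ^ 2 * (R' * Real.exp (-4 * (y / M))) := by
    have := mul_le_mul_of_nonneg_left hD hR
    have := mul_le_mul_of_nonneg_left hB2 hR'
    linarith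
  have h2 : R * (1 - u) ≤ R' * Real.exp (-4 * (y / M)) :=
    le_of_mul_le_mul_left h1 (by positivity)
  have h3 : 1 ≤ (1 - u) * Real.exp (2 * u) := by
    have := Real.add_one_le_exp (2 * u)
    nlinarith
  calc R ≤ R * ((1 - u) * Real.exp (2 * u)) := le_mul_of_one_le_right hR h3
    _ = R * (1 - u) * Real.exp (2 * u) := by ring
    _ ≤ R' * Real.exp (-4 * (y / M)) * Real.exp (2 * u) := by gcongr
    _ = R' * Real.exp (-4 * (M - k - 2) / M + 4 * r ^ 2 / M) := by
      rw [mul_assoc, ← Real.exp_add, hu, hy]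
      ring_nf

open scoped Classical in
/-- The `r`-regular graphs on `Fin n`. -/
noncomputable def regularFinset (n r : ℕ) : Finset (SimpleGraph (Fin n)) :=
  {G | G ∈ regularGraphs n r}

theorem regularCut_subset (k : ℕ) : regularCut n r A k ⊆ regularFinset n r := by
  intro G hG
  simp only [regularCut, regularFinset, Finset.mem_filter] at hG ⊢
  exact ⟨hG.1, hG.2.1⟩

/-- Telescoping the ratio bound from `k` up to the first value above `M - 2`. The term linear in
`M - k` collects the errors of the at most `(M - k) / 2` steps, and `4 / M` makes the exponent
nonnegative where the telescoping ends. -/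
theorem card_regularCut_le (hA : 2 * A.card ≤ n) (hM : M = r * A.card / 2) (hMpos : 0 < M)
    (hr : 4 * (r : ℝ) ^ 2 ≤ M) {k : ℕ} (hk : (k : ℝ) ≤ M) :
    ((regularCut n r A k).card : ℝ) ≤ (regularFinset n r).card *
      Real.exp (-(M - k) ^ 2 / M + (2 * r ^ 2 + 2) * (M - k) / M + 4 / M) := by
  obtain ⟨j, hj⟩ := exists_nat_gt M
  -- Induction on the number `j` of switching steps still possible.
  have key : ∀ j k : ℕ, (k : ℝ) ≤ M → M < k + 2 * (j + 1) →
      ((regularCut n r A k).card : ℝ) ≤ (regularFinset n r).card *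
        Real.exp (-(M - k) ^ 2 / M + (2 * r ^ 2 + 2) * (M - k) / M + 4 / M) := by
    intro j
    induction j with
    | zero =>
      intro k hk hj
      have h1 : ((regularCut n r A k).card : ℝ) ≤ (regularFinset n r).card := by
        exact_mod_cast Finset.card_le_card (regularCut_subset k)
      refine h1.trans (le_mul_of_one_le_right (Nat.cast_nonneg _) (Real.one_le_exp ?_))
      rw [← add_div, ← add_div]
      refine div_nonneg ?_ hMpos.le
      have h2 : 0 ≤ M - k := by linarith
      have h3 : M - k ≤ 2 := by push_cast at hj; linarith
      have h4 : 0 ≤ (2 * (r : ℝ) ^ 2 + 2) * (M - k) := by positivity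
      nlinarith
    | succ j ih =>
      intro k hk hj
      by_cases hk2 : (k : ℝ) + 2 ≤ M
      · refine (card_regularCut_le_step hA hM hMpos hr hk2).trans ?_
        have h1 := ih (k + 2) (by push_cast; linarith) (by push_cast at hj ⊢; linarith)
        refine (mul_le_mul_of_nonneg_right h1 (Real.exp_pos _).le).trans ?_
        rw [mul_assoc, ← Real.exp_add]
        refine le_of_eq ?_
        congr 2
        push_cast
        field_simp
        ring
      · exact ih k hk (by
          have : (0 : ℝ) ≤ j := Nat.cast_nonneg _
          linarith)
  exact key j k hk (by
    have : (0 : ℝ) ≤ k := Nat.cast_nonneg _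
    linarith)

end Decay

/-! ### First moment bound for bisections -/

open scoped Classical in
/-- Counting criterion: the proportion of regular graphs violating `P` tends to `0`. -/
theorem holdsWhp_of_card_le {r : ℕ} {P : (n : ℕ) → SimpleGraph (Fin n) → Prop} {ε : ℕ → ℝ}
    (hε : Tendsto ε atTop (𝓝 0))
    (h : ∀ᶠ n in atTop, (((regularFinset n r).filter fun G => ¬ P n G).card : ℝ) ≤
      (regularFinset n r).card * ε n) : HoldsWhp r P := by
  unfold HoldsWhp
  have hlim : Tendsto (fun n => 1 - ENNReal.ofReal (ε n)) (atTop ⊓ 𝓟 {n : ℕ | r < n ∧ Even (n * r)})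
      (𝓝 1) := by
    have := ENNReal.Tendsto.sub (tendsto_const_nhds (x := (1 : ENNReal)))
      ((ENNReal.continuous_ofReal.tendsto 0).comp hε) (by simp)
    simp only [ENNReal.ofReal_zero, tsub_zero] at this
    exact this.mono_left inf_le_left
  have hne : ∀ n, r < n ∧ Even (n * r) → (regularGraphs n r).Nonempty :=
    fun n hn => regularGraphs_nonempty hn.1 hn.2
  refine tendsto_of_tendsto_of_tendsto_of_le_of_le' hlim tendsto_const_nhds ?_ ?_
  · rw [eventually_inf_principal]
    filter_upwards [h] with n hn hpar
    have hadd := uniformOn_compl {G | P n G} (regularGraphs n r).toFinite (hne n hpar)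
    have hF : regularGraphs n r = (regularFinset n r : Set (SimpleGraph (Fin n))) := by
      ext G; simp [regularFinset]
    have hP : {G | P n G}ᶜ = ((Finset.univ.filter fun G => ¬ P n G : Finset _) :
        Set (SimpleGraph (Fin n))) := by
      ext G; simp
    have hpos : 0 < (regularFinset n r).card := by
      rw [Finset.card_pos, ← Finset.coe_nonempty, ← hF]
      exact hne n hpar
    have hle : uniformOn (regularGraphs n r) {G | P n G}ᶜ ≤ ENNReal.ofReal (ε n) := by
      rw [hF, hP, uniformOn_apply_finset, Finset.inter_filter, Finset.inter_univ,
        ENNReal.div_le_iff (by exact_mod_cast hpos.ne') (ENNReal.natCast_ne_top _),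
        ← ENNReal.ofReal_natCast, ← ENNReal.ofReal_natCast,
        ← ENNReal.ofReal_mul' (Nat.cast_nonneg _), mul_comm (ε n)]
      exact ENNReal.ofReal_le_ofReal hn
    rw [← hadd]
    refine (tsub_le_tsub_left hle _).trans ?_
    refine tsub_le_iff_right.2 le_rfl
  · rw [eventually_inf_principal]
    filter_upwards with n hpar
    have := isProbabilityMeasure_uniformOn (regularGraphs n r).toFinite (hne n hpar)
    exact MeasureTheory.prob_le_one

open scoped Classical in
/-- Few regular graphs have a small bisection: union bound over the sets `A` and the sizes of the
cut. -/
theorem card_filter_small_bisection_le {n r : ℕ} {c : ℝ} (hc : 0 < c) (hr : 1 ≤ r) (hn : 1 ≤ n)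
    (hn1 : 4 * (r : ℝ) ^ 2 ≤ r * (n / 2 : ℕ) / 2)
    (hn2 : (r : ℝ) / 4 ≤ c * √r / 2 * n) :
    (((regularFinset n r).filter fun G => ∃ A : Finset (Fin n), A.card = n / 2 ∧
      (edgeBoundaryCard G A : ℝ) < (r / 4 - c * √r / 2) * n).card : ℝ) ≤
      (regularFinset n r).card *
        (r * Real.exp (c * √r + 2 * r ^ 2 + 3) *
          (n * Real.exp (-(c ^ 2 - Real.log 2) * n))) := by
  set M : ℝ := r * (n / 2 : ℕ) / 2 with hM
  have hr' : (1 : ℝ) ≤ r := by exact_mod_cast hr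
  have hn' : (1 : ℝ) ≤ n := by exact_mod_cast hn
  have hM4 : 4 ≤ M := le_trans (by nlinarith) hn1
  have hs0 : 0 ≤ √(r : ℝ) := Real.sqrt_nonneg _
  have hs : √(r : ℝ) ^ 2 = r := Real.sq_sqrt (by linarith)
  have hfl1 : ((n / 2 : ℕ) : ℝ) ≤ n / 2 := Nat.cast_div_le
  have hfl2 : ((n : ℝ) - 1) / 2 ≤ (n / 2 : ℕ) := by
    have : (n : ℝ) ≤ 2 * (n / 2 : ℕ) + 1 := by
      exact_mod_cast (by omega : n ≤ 2 * (n / 2) + 1)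
    linarith
  have hMle : M ≤ r * n / 4 := by rw [hM]; nlinarith
  have hMge : r * n / 4 - r / 4 ≤ M := by rw [hM]; nlinarith
  have hcut : ∀ A : Finset (Fin n), A.card = n / 2 → ∀ k : ℕ,
      (k : ℝ) < (r / 4 - c * √r / 2) * n →
      ((regularCut n r A k).card : ℝ) ≤ (regularFinset n r).card *
        Real.exp (c * √r + 2 * r ^ 2 + 3 - c ^ 2 * n) := by
    intro A hA k hk
    have hd : c * √r / 2 * n - r / 4 ≤ M - k := by linarith
    have hd0 : 0 ≤ M - k := by linarith
    refine (card_regularCut_le (M := M) (by omega) (by rw [hA]) (by linarith) hn1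
      (by linarith)).trans ?_
    refine mul_le_mul_of_nonneg_left (Real.exp_le_exp.2 ?_) (Nat.cast_nonneg _)
    have t1 : 4 / M ≤ 1 := by rw [div_le_one (by linarith)]; exact hM4
    have t2 : (2 * (r : ℝ) ^ 2 + 2) * (M - k) / M ≤ 2 * r ^ 2 + 2 := by
      rw [div_le_iff₀ (by linarith)]
      have : (0 : ℝ) ≤ k := Nat.cast_nonneg _
      gcongr
      linarith
    -- Here `M ≤ r n / 4` and `M - k ≥ c √r n / 2 - r / 4`, the loss `r / 4` being due to odd `n`.
    have t3 : c ^ 2 * n - c * √r ≤ (M - k) ^ 2 / M := by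
      rw [le_div_iff₀ (by linarith)]
      have hsq : (c * √r / 2 * n - r / 4) ^ 2 ≤ (M - k) ^ 2 :=
        pow_le_pow_left₀ (by linarith) hd 2
      refine le_trans ?_ hsq
      by_cases hneg : c ^ 2 * n - c * √r ≤ 0
      · exact le_trans (mul_nonpos_of_nonpos_of_nonneg hneg (by linarith)) (sq_nonneg _)
      · have := mul_le_mul_of_nonneg_left hMle (not_le.1 hneg).le
        have e : (c * √r / 2 * n - r / 4) ^ 2 =
            (c ^ 2 * n - c * √r) * (r * n / 4) + (r : ℝ) ^ 2 / 16 := by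
          linear_combination (c ^ 2 * n ^ 2 / 4) * hs
        rw [e]
        linarith [sq_nonneg (r : ℝ)]
    rw [neg_div]
    linarith
  have hsub : ((regularFinset n r).filter fun G => ∃ A : Finset (Fin n), A.card = n / 2 ∧
      (edgeBoundaryCard G A : ℝ) < (r / 4 - c * √r / 2) * n) ⊆
      (Finset.univ.filter fun A : Finset (Fin n) => A.card = n / 2).biUnion fun A =>
        ((Finset.range (r * n)).filter fun k : ℕ => (k : ℝ) < (r / 4 - c * √r / 2) * n).biUnion
          fun k => regularCut n r A k := by
    intro G hG
    simp only [Finset.mem_filter, regularFinset, Finset.mem_univ, true_and] at hG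
    obtain ⟨hG, A, hA, hlt⟩ := hG
    simp only [Finset.mem_biUnion, Finset.mem_filter, Finset.mem_univ, true_and]
    refine ⟨A, hA, edgeBoundaryCard G A, ⟨?_, hlt⟩, by simp [regularCut, hG]⟩
    rw [Finset.mem_range]
    have : (edgeBoundaryCard G A : ℝ) < r * n := by
      refine hlt.trans_le ?_
      have : 0 ≤ c * √r / 2 * n := by positivity
      nlinarith
    exact_mod_cast this
  set E := Real.exp (c * √r + 2 * r ^ 2 + 3 - c ^ 2 * n) with hE
  set F := ((regularFinset n r).card : ℝ)
  have hF : 0 ≤ F := Nat.cast_nonneg _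
  have hEpos : 0 < E := Real.exp_pos _
  calc _ ≤ ∑ A ∈ (Finset.univ.filter fun A : Finset (Fin n) => A.card = n / 2),
        ∑ k ∈ ((Finset.range (r * n)).filter fun k : ℕ => (k : ℝ) < (r / 4 - c * √r / 2) * n),
          ((regularCut n r A k).card : ℝ) := by
        have h1 := (Finset.card_le_card hsub).trans (Finset.card_biUnion_le.trans
          (Finset.sum_le_sum fun A _ => Finset.card_biUnion_le))
        exact_mod_cast h1
    _ ≤ ∑ A ∈ (Finset.univ.filter fun A : Finset (Fin n) => A.card = n / 2),
        ((r * n : ℕ) : ℝ) * (F * E) := by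
        refine Finset.sum_le_sum fun A hA => ?_
        refine (Finset.sum_le_card_nsmul _ _ (F * E) fun k hk => ?_).trans ?_
        · exact hcut A (Finset.mem_filter.1 hA).2 k (Finset.mem_filter.1 hk).2
        · rw [nsmul_eq_mul]
          refine mul_le_mul_of_nonneg_right ?_ (by positivity)
          exact_mod_cast (Finset.card_filter_le _ _).trans (Finset.card_range _).le
    _ ≤ (2 : ℝ) ^ n * (((r * n : ℕ) : ℝ) * (F * E)) := by
        rw [Finset.sum_const, nsmul_eq_mul]
        refine mul_le_mul_of_nonneg_right ?_ (by positivity)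
        have := Finset.card_filter_le (Finset.univ : Finset (Finset (Fin n)))
          (fun A => A.card = n / 2)
        rw [Finset.card_univ, Fintype.card_finset, Fintype.card_fin] at this
        exact_mod_cast this
    _ = _ := by
        have h2 : (2 : ℝ) ^ n = Real.exp (Real.log 2 * n) := by
          rw [Real.exp_mul, Real.exp_log (by norm_num), Real.rpow_natCast]
        have h3 : Real.exp (c * √r + 2 * r ^ 2 + 3) * Real.exp (-(c ^ 2 - Real.log 2) * n) =
            Real.exp (Real.log 2 * n) * E := by
          rw [hE, ← Real.exp_add, ← Real.exp_add]
          ring_nf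
        rw [h2]
        push_cast
        linear_combination (-(F * r * n)) * h3

/-- With high probability all bisections of the random regular graph are large. The conjunct
`2 ≤ n` records that only large `n` matter. -/
theorem holdsWhp_bisection {r : ℕ} (hr : 1 ≤ r) {c : ℝ} (hc : 0 < c)
    (hc2 : Real.log 2 < c ^ 2) :
    HoldsWhp r fun n G => 2 ≤ n ∧ ∀ A : Finset (Fin n), A.card = n / 2 →
      (r / 4 - c * √r / 2) * n ≤ (edgeBoundaryCard G A : ℝ) := by
  classical
  have hr' : (0 : ℝ) < r := by exact_mod_cast hr
  refine holdsWhp_of_card_le (ε := fun n : ℕ => r * Real.exp (c * √r + 2 * r ^ 2 + 3) *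
          (n * Real.exp (-(c ^ 2 - Real.log 2) * n))) ?_ ?_
  · have h1 := (tendsto_rpow_mul_exp_neg_mul_atTop_nhds_zero 1 (c ^ 2 - Real.log 2)
      (by linarith)).comp (tendsto_natCast_atTop_atTop (R := ℝ))
    have h2 := h1.const_mul (r * Real.exp (c * √r + 2 * r ^ 2 + 3))
    simpa using h2
  · have hlarge : ∀ᶠ n : ℕ in atTop, (r : ℝ) / 4 ≤ c * √r / 2 * n :=
      (tendsto_natCast_atTop_atTop.const_mul_atTop (by positivity)).eventually_ge_atTop _
    filter_upwards [hlarge, eventually_ge_atTop (16 * r + 2)] with n hn hn2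
    have hn3 : 4 * (r : ℝ) ^ 2 ≤ r * (n / 2 : ℕ) / 2 := by
      have : 8 * (r : ℝ) ≤ (n / 2 : ℕ) := by exact_mod_cast (by omega : 8 * r ≤ n / 2)
      nlinarith
    refine le_trans ?_ (card_filter_small_bisection_le hc hr (by omega) hn3 hn)
    refine Nat.cast_le.2 (Finset.card_le_card fun G => ?_)
    simp only [Finset.mem_filter]
    rintro ⟨hG, hbad⟩
    refine ⟨hG, ?_⟩
    push Not at hbad
    exact hbad (by omega)

theorem HoldsWhp.mono {r : ℕ} {P Q : (n : ℕ) → SimpleGraph (Fin n) → Prop} (hP : HoldsWhp r P)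
    (h : ∀ n G, P n G → Q n G) : HoldsWhp r Q := by
  refine tendsto_of_tendsto_of_tendsto_of_le_of_le' hP tendsto_const_nhds ?_ ?_
  · exact Eventually.of_forall fun n => MeasureTheory.measure_mono fun G hG => h n G hG
  · rw [eventually_inf_principal]
    filter_upwards with n hpar
    have := isProbabilityMeasure_uniformOn (regularGraphs n r).toFinite
      (regularGraphs_nonempty hpar.1 hpar.2)
    exact MeasureTheory.prob_le_one

end IsingRegular

open IsingRegular in
theorem proposition4p1 :
    (∀ (n : ℕ) (_ : 2 ≤ n) (G : SimpleGraph (Fin n)) (h : ℝ),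
      0 < h → h < isoperimetricNumber G →
        communicationHeight G h (allMinus n) (allPlus n) - hamiltonian G h (allMinus n) ≥
          (isoperimetricNumber G - h) * (2 * (⌊(n : ℝ) / 2⌋₊ : ℝ))) ∧
    (∀ C₀ : ℝ, 0 < C₀ → C₀ < √3 / 2 - √(Real.log 2) →
      ∃ C₁ : ℝ, 0 < C₁ ∧ C₁ < √3 / 2 ∧
        ∀ (r : ℕ) (h : ℝ), 3 ≤ r → 0 < h → h < C₀ * √(r : ℝ) →
          HoldsWhp r fun n G =>
            communicationHeight G h (allMinus n) (allPlus n) - hamiltonian G h (allMinus n) ≥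
              ((r : ℝ) / 2 - C₁ * √(r : ℝ)) * (n : ℝ)) := by
  refine ⟨fun n hn G h _ _ => communicationHeight_ge_isoperimetric hn G h, fun C₀ h0 h1 => ?_⟩
  have hlog : 0 ≤ √(Real.log 2) := Real.sqrt_nonneg _
  -- The exponent `c` lies halfway between `√(log 2)` and `√3 / 2 - C₀`.
  obtain ⟨c, hc⟩ : ∃ c, c = (√(Real.log 2) + (√3 / 2 - C₀)) / 2 := ⟨_, rfl⟩
  have hcpos : 0 < c := by linarith
  have hc2 : Real.log 2 < c ^ 2 := by
    rw [← Real.sqrt_lt' hcpos]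
    linarith
  -- The field lowers the barrier by at most `C₀ √r n`, which is why `C₁ = C₀ + c` works.
  refine ⟨C₀ + c, by linarith, by linarith, fun r h hr hh hhC => ?_⟩
  refine (holdsWhp_bisection (by omega) hcpos hc2).mono fun n G ⟨hn, hG⟩ => ?_
  refine le_communicationHeight_sub (by omega) G h _ fun A hA => ?_
  have h2 := hG A hA
  have h3 : (A.card : ℝ) ≤ n / 2 := by rw [hA]; exact Nat.cast_div_le
  have h4 : h * (2 * A.card) ≤ C₀ * √r * n :=
    mul_le_mul hhC.le (by linarith) (by positivity) (by positivity)
  linarith
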